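/- Let $K=K(k)=\int_0^{\pi/2}\frac{d\theta}{\sqrt{1-k^2\sin^2\theta}}$, $K'=K(\sqrt{1-k^2})$, and let $\mathrm{sn},\mathrm{cn},\mathrm{dn}$ be the Jacobi elliptic functions of modulus $k\in(0,1)$, as meromorphic functions on $\mathbb{C}$. For real $s_2,s_4$, an \emph{elliptic function solution} with parameters $(s_2,s_4)$ is a nonconstant $C^3$ function $u:\mathbb{R}\to\mathbb{R}$, $u=u(\xi)$, which is a stationary solution of the focusing mKdV equation in the moving frame $\xi=x-2s_2t$, $$u_t-2s_2u_\xi+u_{\xi\xi\xi}+6u^2u_\xi=0,$$ which satisfies $u_\xi^2=-R(u)$ with $R(u)=(u^2-s_2)^2-4s_4$, and for which the curve $y^2=\lambda^4+s_2\lambda^2+s_4$ has genus one, i.e. $\lambda^4+s_2\lambda^2+s_4$ has four distinct complex roots. (1) For every elliptic function solution $u$ with parameters $(s_2,s_4)$ there are real numbers $u_1\le 0\le u_2<u_3$, $\alpha>0$, $k\in(0,1)$, $l\in\{0,\frac{K'}{2}\}$, $\xi_0\in\mathbb{R}$ and $\sigma\in\{1,-1\}$ such that $X\big((X-s_2)^2-4s_4\big)=(X-u_1)(X-u_2)(X-u_3)$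 for all real $X$, $s_2=\frac12(u_1+u_2+u_3)$, $$k=\sqrt{\frac{u_3-u_2}{u_3-u_1}},\qquad \alpha^2=u_3-u_1,$$ $$u_1=-\alpha^2\mathrm{dn}^2(K+2\mathrm{i}l),\qquad u_2=-k^2\alpha^2\mathrm{cn}^2(K+2\mathrm{i}l),\qquad u_3=k^2\alpha^2\mathrm{sn}^2(K+2\mathrm{i}l),$$ and, for all $\xi\in\mathbb{R}$, $$u^2(\xi)=k^2\alpha^2\big(\mathrm{sn}^2(K+2\mathrm{i}l)-\mathrm{sn}^2(\alpha(\xi-\xi_0))\big).$$ Moreover, either $l=0$ and $u(\xi)=\sigma k\alpha\,\mathrm{cn}(\alpha(\xi-\xi_0))$ for all $\xi\in\mathbb{R}$ ($\mathrm{cn}$-type), or $l=\frac{K'}{2}$ and $u(\xi)=\sigma\alpha\,\mathrm{dn}(\alpha(\xi-\xi_0))$ for all $\xi\in\mathbb{R}$ ($\mathrm{dn}$-type). (2) Conversely, for all $\alpha>0$, $k\in(0,1)$ and $l\in\{0,\frac{K'}{2}\}$ there are real numbers $u_1\le 0\le u_2<u_3$ and $s_4$ and an elliptic function solution $u$ with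 parameters $(s_2,s_4)$, $s_2=\frac12(u_1+u_2+u_3)$, for which all the relations of (1) hold with $\xi_0=0$ and $\sigma=1$. That is, $u(\xi)=k\alpha\,\mathrm{cn}(\alpha\xi)$ if $l=0$, $u(\xi)=\alpha\,\mathrm{dn}(\alpha\xi)$ if $l=\frac{K'}{2}$, and $u^2(\xi)=k^2\alpha^2(\mathrm{sn}^2(K+2\mathrm{i}l)-\mathrm{sn}^2(\alpha\xi))$. -/

import Mathlib

namespace MKdV

open Complex (I)

/-- Incomplete elliptic integral of the first kind `F(φ, k)`. -/
noncomputable def ellipticF (k φ : ℝ) : ℝ :=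
  ∫ θ in (0 : ℝ)..φ, 1 / Real.sqrt (1 - k ^ 2 * Real.sin θ ^ 2)

/-- Complete elliptic integral of the first kind `K(k)`. -/
noncomputable def ellipticK (k : ℝ) : ℝ :=
  ∫ θ in (0 : ℝ)..(Real.pi / 2), 1 / Real.sqrt (1 - k ^ 2 * Real.sin θ ^ 2)

/-- Complementary modulus `k' = √(1 - k²)`. -/
noncomputable def compl (k : ℝ) : ℝ := Real.sqrt (1 - k ^ 2)

/-- Associated complete elliptic integral `K' = K(k')`. -/
noncomputable def ellipticK' (k : ℝ) : ℝ := ellipticK (compl k)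

/-- Jacobi amplitude: the inverse function of the bijection `φ ↦ F(φ, k)` of `ℝ`
(see `ellipticF_bijective`). -/
noncomputable def am (k x : ℝ) : ℝ := Function.invFun (ellipticF k) x

/-- Jacobi `sn` of modulus `k` at a real argument: the sine of the amplitude. -/
noncomputable def snR (k x : ℝ) : ℝ := Real.sin (am k x)

/-- Jacobi `cn` at a real argument; see `snR`. -/
noncomputable def cnR (k x : ℝ) : ℝ := Real.cos (am k x)

/-- Jacobi `dn` at a real argument; see `snR`. -/
noncomputable def dnR (k x : ℝ) : ℝ := Real.sqrt (1 - k ^ 2 * Real.sin (am k x) ^ 2)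

/-- Common denominator `cn²(y, k') + k² sn²(x, k) sn²(y, k')` of the three Jacobi functions at
`z = x + i y`. It vanishes exactly at their poles. -/
noncomputable def jacobiDen (k : ℝ) (z : ℂ) : ℂ :=
  ((cnR (compl k) z.im ^ 2 + k ^ 2 * snR k z.re ^ 2 * snR (compl k) z.im ^ 2 : ℝ) : ℂ)

/-- Jacobi `sn(z, k)` for complex `z = x + i y`: the meromorphic continuation from the real line,
given by Jacobi's imaginary transformation (`sn(iy, k) = i sn(y, k') / cn(y, k')`,
`cn(iy, k) = 1 / cn(y, k')`, `dn(iy, k) = dn(y, k') / cn(y, k')`) and the addition theorem. -/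
noncomputable def sn (k : ℝ) (z : ℂ) : ℂ :=
  (snR k z.re * dnR (compl k) z.im
    + I * (cnR k z.re * dnR k z.re * snR (compl k) z.im * cnR (compl k) z.im)) / jacobiDen k z

/-- Jacobi `cn(z, k)` for complex `z`; see `sn`. -/
noncomputable def cn (k : ℝ) (z : ℂ) : ℂ :=
  (cnR k z.re * cnR (compl k) z.im
    - I * (snR k z.re * dnR k z.re * snR (compl k) z.im * dnR (compl k) z.im)) / jacobiDen k z

/-- Jacobi `dn(z, k)` for complex `z`; see `sn`. -/
noncomputable def dn (k : ℝ) (z : ℂ) : ℂ :=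
  (dnR k z.re * cnR (compl k) z.im * dnR (compl k) z.im
    - I * (k ^ 2 * snR k z.re * cnR k z.re * snR (compl k) z.im)) / jacobiDen k z

theorem one_sub_pos {k : ℝ} (h0 : 0 ≤ k) (h1 : k < 1) (θ : ℝ) :
    0 < 1 - k ^ 2 * Real.sin θ ^ 2 := by
  nlinarith [Real.sin_sq_le_one θ, sq_nonneg (Real.sin θ), mul_nonneg h0 (sq_nonneg (Real.sin θ))]

theorem continuous_integrand {k : ℝ} (h0 : 0 ≤ k) (h1 : k < 1) :
    Continuous fun θ : ℝ => 1 / Real.sqrt (1 - k ^ 2 * Real.sin θ ^ 2) := by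
  refine Continuous.div continuous_const (by fun_prop) fun θ => ?_
  exact (Real.sqrt_pos.2 (one_sub_pos h0 h1 θ)).ne'

theorem hasDerivAt_ellipticF {k : ℝ} (h0 : 0 ≤ k) (h1 : k < 1) (φ : ℝ) :
    HasDerivAt (ellipticF k) (1 / Real.sqrt (1 - k ^ 2 * Real.sin φ ^ 2)) φ :=
  ((continuous_integrand h0 h1).integral_hasStrictDerivAt 0 φ).hasDerivAt

/-- For `0 ≤ k < 1` the map `φ ↦ F(φ, k)` is a bijection of the real line, so that `am` is a
genuine inverse. -/
theorem ellipticF_bijective {k : ℝ} (h0 : 0 ≤ k) (h1 : k < 1) :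
    Function.Bijective (ellipticF k) := by
  have hd := hasDerivAt_ellipticF h0 h1
  have hmono : Monotone fun φ => ellipticF k φ - φ := by
    have hd' : ∀ φ, HasDerivAt (fun φ => ellipticF k φ - φ)
        (1 / Real.sqrt (1 - k ^ 2 * Real.sin φ ^ 2) - 1) φ :=
      fun φ => (hd φ).sub (hasDerivAt_id φ)
    refine monotone_of_deriv_nonneg (fun φ => (hd' φ).differentiableAt) fun φ => ?_
    rw [(hd' φ).deriv, sub_nonneg, le_div_iff₀ (Real.sqrt_pos.2 (one_sub_pos h0 h1 φ)), one_mul]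
    exact Real.sqrt_le_one.2 (by nlinarith [sq_nonneg (k * Real.sin φ)])
  have hF0 : ellipticF k 0 = 0 := by simp [ellipticF]
  refine ⟨StrictMono.injective fun a b hab => ?_, Continuous.surjective ?_ ?_ ?_⟩
  · have := hmono hab.le
    simp only at this
    linarith
  · exact continuous_iff_continuousAt.2 fun φ => (hd φ).continuousAt
  · refine Filter.tendsto_atTop_mono' _ ?_ Filter.tendsto_id
    filter_upwards [Filter.eventually_ge_atTop 0] with φ hφ
    have := hmono hφ
    simp only [hF0] at this
    simp only [id]
    linarith
  · refine Filter.tendsto_atBot_mono' _ ?_ Filter.tendsto_id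
    filter_upwards [Filter.eventually_le_atBot 0] with φ hφ
    have := hmono hφ
    simp only [hF0] at this
    simp only [id]
    linarith

/-- Classical solutions `w(ξ, t)` of the focusing mKdV equation in the moving frame
`ξ = x - 2 s₂ t`: `w_t - 2 s₂ w_ξ + w_ξξξ + 6 w² w_ξ = 0`. -/
def IsMovingMKdVSolution (s₂ : ℝ) (w : ℝ → ℝ → ℝ) : Prop :=
  ContDiff ℝ 3 (fun p : ℝ × ℝ => w p.1 p.2) ∧
    ∀ ξ t : ℝ,
      deriv (fun τ => w ξ τ) t - 2 * s₂ * deriv (fun η => w η t) ξ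
        + iteratedDeriv 3 (fun η => w η t) ξ
        + 6 * w ξ t ^ 2 * deriv (fun η => w η t) ξ = 0

/-- `R(v) = (v² - s₂)² - 4 s₄`. -/
def R (s₂ s₄ v : ℝ) : ℝ := (v ^ 2 - s₂) ^ 2 - 4 * s₄

/-- The polynomial `λ⁴ + s₂ λ² + s₄` of the spectral curve `y² = λ⁴ + s₂ λ² + s₄`. -/
noncomputable def spectralPoly (s₂ s₄ : ℝ) : Polynomial ℂ :=
  Polynomial.X ^ 4 + Polynomial.C (s₂ : ℂ) * Polynomial.X ^ 2 + Polynomial.C (s₄ : ℂ)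

/-- Elliptic function solutions `u = u(ξ)` with parameters `s₂`, `s₄`: nonconstant real stationary
solutions of the mKdV equation in the moving frame with `u_ξ² = -R(u)`, for which the spectral
curve has genus one (four distinct branch points). -/
structure IsEllipticSolution (s₂ s₄ : ℝ) (u : ℝ → ℝ) : Prop where
  solution : IsMovingMKdVSolution s₂ (fun ξ _ => u ξ)
  profile : ∀ ξ, deriv u ξ ^ 2 = -R s₂ s₄ (u ξ)
  genus_one : Squarefree (spectralPoly s₂ s₄)
  nonconstant : ∃ ξ η, u ξ ≠ u η

/-- The relations between `(u₁, u₂, u₃)` and `(α, k, l)`: the two formulas for the modulus `k` and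
the scale `α`, and the parametrization of `u₁, u₂, u₃` by values at `K + 2 i l`. -/
structure Parametrized (u₁ u₂ u₃ α k l : ℝ) : Prop where
  modulus : k = Real.sqrt ((u₃ - u₂) / (u₃ - u₁))
  scale : α ^ 2 = u₃ - u₁
  first : (u₁ : ℂ) = -(α : ℂ) ^ 2 * dn k (ellipticK k + 2 * I * l) ^ 2
  second : (u₂ : ℂ) = -(k : ℂ) ^ 2 * (α : ℂ) ^ 2 * cn k (ellipticK k + 2 * I * l) ^ 2
  third : (u₃ : ℂ) = (k : ℂ) ^ 2 * (α : ℂ) ^ 2 * sn k (ellipticK k + 2 * I * l) ^ 2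

/-- `u²(ξ) = k² α² (sn²(K + 2 i l) - sn²(α (ξ - ξ₀)))` for all real `ξ`. -/
def SquareFormula (α k l ξ₀ : ℝ) (u : ℝ → ℝ) : Prop :=
  ∀ ξ : ℝ, (u ξ : ℂ) ^ 2 = (k : ℂ) ^ 2 * (α : ℂ) ^ 2 *
    (sn k (ellipticK k + 2 * I * l) ^ 2 - sn k ((α * (ξ - ξ₀) : ℝ) : ℂ) ^ 2)

/-- `u` is of `cn`-type with `l = 0`, or of `dn`-type with `l = K'/2`, up to an overall sign `σ`
and the translation `ξ₀`. -/
def CnOrDnType (α k l ξ₀ σ : ℝ) (u : ℝ → ℝ) : Prop :=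
  (l = 0 ∧ ∀ ξ : ℝ, (u ξ : ℂ) = σ * (k * α * cn k ((α * (ξ - ξ₀) : ℝ) : ℂ))) ∨
  (l = ellipticK' k / 2 ∧ ∀ ξ : ℝ, (u ξ : ℂ) = σ * (α * dn k ((α * (ξ - ξ₀) : ℝ) : ℂ)))

end MKdV

/-! The stationary equation reads `u''' = 2 s₂ u' - 6 u² u'` and integrates to `u'' = 2 s₂ u - 2 u³
+ c`. Differentiating `u'² = -R(u)` where `u' ≠ 0` forces `c = 0`
(`IsEllipticSolution.hasDerivAt_deriv`). The second-order Duffing equation is needed because the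
first-order one loses uniqueness at turning points.

A point with `u' ≠ 0` gives `s₄ = r² > 0`, and `X((X - s₂)² - 4s₄)` has roots `0`, `s₂ ± 2r` with
`s₂ + 2r > 0`. Genus one excludes `s₂ = 2r`. For `s₂ < 2r` zero is the middle root, which is the
`cn` case. For `s₂ > 2r` zero is the lowest root, which is the `dn` case
(`IsEllipticSolution.exists_scale_modulus`).

In each case some translate of the model profile (up to sign for `dn`) has the same value and slope
as `u` at `0`, and `duffing_unique` identifies the two. The converse checks that the profiles solve
the equation. The formulas in `l` only need the Jacobi functions at `K` and at `K + iK'`. -/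

namespace MKdV

open Complex (I)

/-! ### Real Jacobi functions: derivatives, parity, ranges and special values. -/

section RealJacobi

variable {k : ℝ}

theorem strictMono_ellipticF (h0 : 0 ≤ k) (h1 : k < 1) : StrictMono (ellipticF k) :=
  strictMono_of_deriv_pos fun φ => by
    rw [(hasDerivAt_ellipticF h0 h1 φ).deriv]
    exact one_div_pos.2 (Real.sqrt_pos.2 (one_sub_pos h0 h1 φ))

theorem am_ellipticF (h0 : 0 ≤ k) (h1 : k < 1) (φ : ℝ) : am k (ellipticF k φ) = φ :=
  Function.leftInverse_invFun (ellipticF_bijective h0 h1).1 φ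

theorem ellipticF_am (h0 : 0 ≤ k) (h1 : k < 1) (x : ℝ) : ellipticF k (am k x) = x :=
  Function.rightInverse_invFun (ellipticF_bijective h0 h1).2 x

theorem am_zero (h0 : 0 ≤ k) (h1 : k < 1) : am k 0 = 0 := by
  simpa [ellipticF] using am_ellipticF h0 h1 0

theorem am_ellipticK (h0 : 0 ≤ k) (h1 : k < 1) : am k (ellipticK k) = Real.pi / 2 :=
  am_ellipticF h0 h1 (Real.pi / 2)

theorem ellipticF_neg (k φ : ℝ) : ellipticF k (-φ) = -ellipticF k φ := by
  unfold ellipticF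
  have h := intervalIntegral.integral_comp_neg (a := 0) (b := φ)
    fun θ => 1 / Real.sqrt (1 - k ^ 2 * Real.sin θ ^ 2)
  simp only [Real.sin_neg, neg_sq, neg_zero] at h
  rw [h, intervalIntegral.integral_symm]

theorem am_neg (h0 : 0 ≤ k) (h1 : k < 1) (x : ℝ) : am k (-x) = -am k x := by
  apply (ellipticF_bijective h0 h1).1
  rw [ellipticF_neg, ellipticF_am h0 h1, ellipticF_am h0 h1]

theorem continuous_am (h0 : 0 ≤ k) (h1 : k < 1) : Continuous (am k) := by
  refine Monotone.continuous_of_surjective (fun x y hxy => ?_) fun φ => ⟨_, am_ellipticF h0 h1 φ⟩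
  rwa [← (strictMono_ellipticF h0 h1).le_iff_le, ellipticF_am h0 h1, ellipticF_am h0 h1]

/-- Inverse function rule: the reciprocal of the integrand of `ellipticF` at `am k x` is `dnR k x`.
-/
theorem hasDerivAt_am (h0 : 0 ≤ k) (h1 : k < 1) (x : ℝ) : HasDerivAt (am k) (dnR k x) x := by
  have h := HasDerivAt.of_local_left_inverse (continuous_am h0 h1).continuousAt
    (hasDerivAt_ellipticF h0 h1 (am k x))
    (one_div_pos.2 (Real.sqrt_pos.2 (one_sub_pos h0 h1 _))).ne'
    (Filter.Eventually.of_forall (ellipticF_am h0 h1))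
  simpa [dnR] using h

theorem snR_sq_add_cnR_sq (k x : ℝ) : snR k x ^ 2 + cnR k x ^ 2 = 1 :=
  Real.sin_sq_add_cos_sq _

theorem dnR_sq (h0 : 0 ≤ k) (h1 : k < 1) (x : ℝ) : dnR k x ^ 2 = 1 - k ^ 2 * snR k x ^ 2 :=
  Real.sq_sqrt (one_sub_pos h0 h1 _).le

theorem dnR_pos (h0 : 0 ≤ k) (h1 : k < 1) (x : ℝ) : 0 < dnR k x :=
  Real.sqrt_pos.2 (one_sub_pos h0 h1 _)

theorem hasDerivAt_snR (h0 : 0 ≤ k) (h1 : k < 1) (x : ℝ) :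
    HasDerivAt (snR k) (cnR k x * dnR k x) x :=
  (hasDerivAt_am h0 h1 x).sin

theorem hasDerivAt_cnR (h0 : 0 ≤ k) (h1 : k < 1) (x : ℝ) :
    HasDerivAt (cnR k) (-(snR k x * dnR k x)) x := by
  exact ((hasDerivAt_am h0 h1 x).cos).congr_deriv (neg_mul _ _)

theorem hasDerivAt_dnR (h0 : 0 ≤ k) (h1 : k < 1) (x : ℝ) :
    HasDerivAt (dnR k) (-(k ^ 2 * (snR k x * cnR k x))) x := by
  have h := ((((hasDerivAt_snR h0 h1 x).pow 2).const_mul (k ^ 2)).const_sub 1).sqrt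
    (one_sub_pos h0 h1 (am k x)).ne'
  refine h.congr_deriv ?_
  have hd := (dnR_pos h0 h1 x).ne'
  change -(k ^ 2 * (_ * (cnR k x * dnR k x))) / (2 * dnR k x) = _
  field_simp
  simp
  ring

theorem snR_neg (h0 : 0 ≤ k) (h1 : k < 1) (x : ℝ) : snR k (-x) = -snR k x := by
  simp [snR, am_neg h0 h1]

theorem cnR_neg (h0 : 0 ≤ k) (h1 : k < 1) (x : ℝ) : cnR k (-x) = cnR k x := by
  simp [cnR, am_neg h0 h1]

theorem dnR_neg (h0 : 0 ≤ k) (h1 : k < 1) (x : ℝ) : dnR k (-x) = dnR k x := by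
  simp [dnR, am_neg h0 h1]

theorem exists_cnR_eq (h0 : 0 ≤ k) (h1 : k < 1) {c : ℝ} (hl : -1 ≤ c) (hu : c ≤ 1) :
    ∃ x, cnR k x = c :=
  ⟨ellipticF k (Real.arccos c), by rw [cnR, am_ellipticF h0 h1, Real.cos_arccos hl hu]⟩

theorem exists_dnR_eq (h0 : 0 < k) (h1 : k < 1) {d : ℝ} (hd : 0 ≤ d) (hl : 1 - k ^ 2 ≤ d ^ 2)
    (hu : d ^ 2 ≤ 1) : ∃ x, dnR k x = d := by
  have hk : 0 < k ^ 2 := by positivity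
  have hs : (1 - d ^ 2) / k ^ 2 ≤ 1 := (div_le_one hk).2 (by linarith)
  have hs0 : 0 ≤ (1 - d ^ 2) / k ^ 2 := div_nonneg (by linarith) hk.le
  refine ⟨ellipticF k (Real.arcsin (Real.sqrt ((1 - d ^ 2) / k ^ 2))), ?_⟩
  rw [dnR, am_ellipticF h0.le h1, Real.sin_arcsin (by linarith [Real.sqrt_nonneg ((1 - d ^ 2) / k ^ 2)])
    (Real.sqrt_le_one.2 hs), Real.sq_sqrt hs0, mul_div_cancel₀ _ hk.ne', sub_sub_cancel,
    Real.sqrt_sq hd]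

theorem snR_zero (h0 : 0 ≤ k) (h1 : k < 1) : snR k 0 = 0 := by simp [snR, am_zero h0 h1]

theorem cnR_zero (h0 : 0 ≤ k) (h1 : k < 1) : cnR k 0 = 1 := by simp [cnR, am_zero h0 h1]

theorem dnR_zero (h0 : 0 ≤ k) (h1 : k < 1) : dnR k 0 = 1 := by simp [dnR, am_zero h0 h1]

theorem snR_ellipticK (h0 : 0 ≤ k) (h1 : k < 1) : snR k (ellipticK k) = 1 := by
  simp [snR, am_ellipticK h0 h1]

theorem cnR_ellipticK (h0 : 0 ≤ k) (h1 : k < 1) : cnR k (ellipticK k) = 0 := by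
  simp [cnR, am_ellipticK h0 h1]

theorem dnR_ellipticK (h0 : 0 ≤ k) (h1 : k < 1) : dnR k (ellipticK k) = compl k := by
  simp [dnR, compl, am_ellipticK h0 h1]

theorem compl_nonneg (k : ℝ) : 0 ≤ compl k := Real.sqrt_nonneg _

theorem compl_lt_one (h0 : 0 < k) : compl k < 1 :=
  (Real.sqrt_lt' one_pos).2 (by nlinarith)

theorem compl_sq (h0 : 0 ≤ k) (h1 : k < 1) : compl k ^ 2 = 1 - k ^ 2 :=
  Real.sq_sqrt (by nlinarith)

theorem compl_compl (h0 : 0 ≤ k) (h1 : k < 1) : compl (compl k) = k := by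
  rw [compl, compl_sq h0 h1, sub_sub_cancel, Real.sqrt_sq h0]

end RealJacobi

/-! ### Jacobi functions on the real axis and at `K + iK'`. -/

section ComplexJacobi

variable {k : ℝ}

theorem jacobiDen_ofReal (h0 : 0 < k) (x : ℝ) : jacobiDen k (x : ℂ) = 1 := by
  simp [jacobiDen, snR_zero (compl_nonneg k) (compl_lt_one h0),
    cnR_zero (compl_nonneg k) (compl_lt_one h0)]

theorem sn_ofReal (h0 : 0 < k) (x : ℝ) : sn k (x : ℂ) = snR k x := by
  simp [sn, jacobiDen_ofReal h0, snR_zero (compl_nonneg k) (compl_lt_one h0),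
    dnR_zero (compl_nonneg k) (compl_lt_one h0)]

theorem cn_ofReal (h0 : 0 < k) (x : ℝ) : cn k (x : ℂ) = cnR k x := by
  simp [cn, jacobiDen_ofReal h0, snR_zero (compl_nonneg k) (compl_lt_one h0),
    cnR_zero (compl_nonneg k) (compl_lt_one h0)]

theorem dn_ofReal (h0 : 0 < k) (x : ℝ) : dn k (x : ℂ) = dnR k x := by
  simp [dn, jacobiDen_ofReal h0, snR_zero (compl_nonneg k) (compl_lt_one h0),
    cnR_zero (compl_nonneg k) (compl_lt_one h0), dnR_zero (compl_nonneg k) (compl_lt_one h0)]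

theorem ellipticK_add_re (k : ℝ) :
    ((ellipticK k : ℂ) + 2 * I * ((ellipticK' k / 2 : ℝ) : ℂ)).re = ellipticK k := by simp

theorem ellipticK_add_im (k : ℝ) :
    ((ellipticK k : ℂ) + 2 * I * ((ellipticK' k / 2 : ℝ) : ℂ)).im = ellipticK' k := by
  simp
  ring

/-- The common denominator of the Jacobi functions at `K + i K'`. -/
theorem jacobiDen_corner (h0 : 0 < k) (h1 : k < 1) :
    jacobiDen k (ellipticK k + 2 * I * ((ellipticK' k / 2 : ℝ) : ℂ)) = k ^ 2 := by
  rw [jacobiDen, ellipticK_add_re, ellipticK_add_im, ellipticK',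
    snR_ellipticK h0.le h1, snR_ellipticK (compl_nonneg k) (compl_lt_one h0),
    cnR_ellipticK (compl_nonneg k) (compl_lt_one h0)]
  simp

/-- Real and imaginary parts both sit at a quarter period, and `dnR (compl k)` there is the
complement of `k'`, that is `k`; dividing by the denominator `k²` leaves `1 / k`. -/
theorem sn_corner (h0 : 0 < k) (h1 : k < 1) :
    sn k (ellipticK k + 2 * I * ((ellipticK' k / 2 : ℝ) : ℂ)) = 1 / k := by
  have hk : (k : ℂ) ≠ 0 := by exact_mod_cast h0.ne'
  rw [sn, jacobiDen_corner h0 h1, ellipticK_add_re, ellipticK_add_im, ellipticK',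
    snR_ellipticK h0.le h1, cnR_ellipticK (compl_nonneg k) (compl_lt_one h0),
    dnR_ellipticK (compl_nonneg k) (compl_lt_one h0), compl_compl h0.le h1]
  field_simp
  simp

theorem cn_corner (h0 : 0 < k) (h1 : k < 1) :
    cn k (ellipticK k + 2 * I * ((ellipticK' k / 2 : ℝ) : ℂ)) = -I * compl k / k := by
  have hk : (k : ℂ) ≠ 0 := by exact_mod_cast h0.ne'
  rw [cn, jacobiDen_corner h0 h1, ellipticK_add_re, ellipticK_add_im, ellipticK',
    snR_ellipticK h0.le h1, cnR_ellipticK h0.le h1, dnR_ellipticK h0.le h1,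
    snR_ellipticK (compl_nonneg k) (compl_lt_one h0),
    dnR_ellipticK (compl_nonneg k) (compl_lt_one h0), compl_compl h0.le h1]
  field_simp
  simp

theorem dn_corner (h0 : 0 < k) (h1 : k < 1) :
    dn k (ellipticK k + 2 * I * ((ellipticK' k / 2 : ℝ) : ℂ)) = 0 := by
  rw [dn, ellipticK_add_re, ellipticK_add_im, ellipticK', cnR_ellipticK h0.le h1,
    cnR_ellipticK (compl_nonneg k) (compl_lt_one h0)]
  simp

end ComplexJacobi

/-! ### Roots, square formula and type in the two cases. -/

section Parametrization

variable {α k : ℝ}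

theorem parametrized_cn (hα : 0 < α) (h0 : 0 < k) (h1 : k < 1) :
    Parametrized (-(α ^ 2 * (1 - k ^ 2))) 0 (k ^ 2 * α ^ 2) α k 0 where
  modulus := by
    rw [show (k ^ 2 * α ^ 2 - 0) / (k ^ 2 * α ^ 2 - -(α ^ 2 * (1 - k ^ 2))) = k ^ 2 by
      field_simp; ring, Real.sqrt_sq h0.le]
  scale := by ring
  first := by
    have h : (compl k : ℂ) ^ 2 = 1 - (k : ℂ) ^ 2 := by exact_mod_cast compl_sq h0.le h1
    simp [dn_ofReal h0, dnR_ellipticK h0.le h1, h]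
  second := by simp [cn_ofReal h0, cnR_ellipticK h0.le h1]
  third := by simp [sn_ofReal h0, snR_ellipticK h0.le h1]

theorem parametrized_dn (hα : 0 < α) (h0 : 0 < k) (h1 : k < 1) :
    Parametrized 0 (α ^ 2 * (1 - k ^ 2)) (α ^ 2) α k (ellipticK' k / 2) where
  modulus := by
    rw [show (α ^ 2 - α ^ 2 * (1 - k ^ 2)) / (α ^ 2 - 0) = k ^ 2 by
      field_simp; ring, Real.sqrt_sq h0.le]
  scale := by ring
  first := by rw [dn_corner h0 h1]; simp
  second := by
    have hk : (k : ℂ) ≠ 0 := by exact_mod_cast h0.ne'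
    have h : (compl k : ℂ) ^ 2 = 1 - (k : ℂ) ^ 2 := by exact_mod_cast compl_sq h0.le h1
    rw [cn_corner h0 h1, div_pow, mul_pow, neg_sq, Complex.I_sq, h]
    push_cast
    field_simp
  third := by
    have hk : (k : ℂ) ≠ 0 := by exact_mod_cast h0.ne'
    rw [sn_corner h0 h1]
    push_cast
    field_simp

theorem squareFormula_cn (h0 : 0 < k) (h1 : k < 1) {ξ₀ σ : ℝ} (hσ : σ = 1 ∨ σ = -1) {u : ℝ → ℝ}
    (hu : ∀ ξ, u ξ = σ * (k * α * cnR k (α * (ξ - ξ₀)))) : SquareFormula α k 0 ξ₀ u := by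
  intro ξ
  have hs : σ ^ 2 = 1 := by rcases hσ with rfl | rfl <;> norm_num
  rw [sn_ofReal h0, Complex.ofReal_zero, mul_zero, add_zero, sn_ofReal h0, snR_ellipticK h0.le h1,
    hu ξ]
  norm_cast
  linear_combination k ^ 2 * α ^ 2 * (cnR k (α * (ξ - ξ₀)) ^ 2 * hs +
    snR_sq_add_cnR_sq k (α * (ξ - ξ₀)))

theorem squareFormula_dn (h0 : 0 < k) (h1 : k < 1) {ξ₀ σ : ℝ} (hσ : σ = 1 ∨ σ = -1) {u : ℝ → ℝ}
    (hu : ∀ ξ, u ξ = σ * (α * dnR k (α * (ξ - ξ₀)))) :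
    SquareFormula α k (ellipticK' k / 2) ξ₀ u := by
  intro ξ
  have hs : σ ^ 2 = 1 := by rcases hσ with rfl | rfl <;> norm_num
  rw [sn_ofReal h0, sn_corner h0 h1, hu ξ]
  norm_cast
  have hk : k ^ 2 * (1 / k) ^ 2 = 1 := by field_simp
  linear_combination α ^ 2 * (dnR k (α * (ξ - ξ₀)) ^ 2 * hs + dnR_sq h0.le h1 (α * (ξ - ξ₀)) - hk)

theorem cnOrDnType_cn (h0 : 0 < k) {ξ₀ σ : ℝ} {u : ℝ → ℝ}
    (hu : ∀ ξ, u ξ = σ * (k * α * cnR k (α * (ξ - ξ₀)))) : CnOrDnType α k 0 ξ₀ σ u := by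
  refine Or.inl ⟨rfl, fun ξ => ?_⟩
  rw [cn_ofReal h0, hu]
  push_cast
  rfl

theorem cnOrDnType_dn (h0 : 0 < k) {ξ₀ σ : ℝ} {u : ℝ → ℝ}
    (hu : ∀ ξ, u ξ = σ * (α * dnR k (α * (ξ - ξ₀)))) :
    CnOrDnType α k (ellipticK' k / 2) ξ₀ σ u := by
  refine Or.inr ⟨rfl, fun ξ => ?_⟩
  rw [dn_ofReal h0, hu]
  push_cast
  rfl

end Parametrization

/-! ### Squarefreeness of the spectral polynomial. -/

section SpectralCurve

theorem squarefree_spectralPoly {s₂ s₄ : ℝ} (h4 : s₄ ≠ 0) (hd : s₂ ^ 2 ≠ 4 * s₄) :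
    Squarefree (spectralPoly s₂ s₄) := by
  apply Polynomial.Separable.squarefree
  set c : ℝ := (2 * (s₂ ^ 2 - 4 * s₄))⁻¹ with hc
  have hc1 : c * (2 * (s₂ ^ 2 - 4 * s₄)) = 1 :=
    inv_mul_cancel₀ (mul_ne_zero two_ne_zero (sub_ne_zero.2 hd))
  have hb1 : s₄⁻¹ * s₄ = 1 := inv_mul_cancel₀ h4
  have hC : (Polynomial.C (c : ℂ)) *
      (2 * (Polynomial.C (s₂ : ℂ) ^ 2 - 4 * Polynomial.C (s₄ : ℂ))) = 1 := by
    have h := congrArg (fun r : ℝ => Polynomial.C (r : ℂ)) hc1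
    simpa [Polynomial.C_ofNat] using h
  have hB : Polynomial.C ((s₄⁻¹ : ℝ) : ℂ) * Polynomial.C (s₄ : ℂ) = 1 := by
    have h := congrArg (fun r : ℝ => Polynomial.C (r : ℂ)) hb1
    simpa using h
  have hder : Polynomial.derivative (spectralPoly s₂ s₄) =
      4 * Polynomial.X ^ 3 + 2 * Polynomial.C (s₂ : ℂ) * Polynomial.X := by
    simp [spectralPoly, Polynomial.C_ofNat]
    ring
  rw [Polynomial.separable_def, hder, spectralPoly]
  generalize Polynomial.C ((s₄⁻¹ : ℝ) : ℂ) = B at *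
  generalize Polynomial.C (s₂ : ℂ) = a at *
  generalize Polynomial.C (s₄ : ℂ) = b at *
  generalize Polynomial.C (c : ℂ) = e at *
  generalize (Polynomial.X : Polynomial ℂ) = x
  -- With `P` the polynomial, `P'(a + 2x²) = 2x(2x² + a)² = 2x(4P + a² - 4b)`, so `x = e(P'(a + 2x²)
  -- - 8xP)`. Substituting this in `b = P - (x³ + ax)x` and multiplying by `B = b⁻¹` gives the
  -- Bézout cofactors.
  refine ⟨B * (1 + (x ^ 3 + a * x) * e * 8 * x), -(B * (x ^ 3 + a * x) * e * (a + 2 * x ^ 2)), ?_⟩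
  linear_combination (1 : Polynomial ℂ) * hB - B * (x ^ 3 + a * x) * x * hC

/-- If `s₂² = 4s₄`, the polynomial is the square of `λ² + s₂/2`. -/
theorem discrim_ne_of_squarefree {s₂ s₄ : ℝ} (h : Squarefree (spectralPoly s₂ s₄)) :
    s₂ ^ 2 ≠ 4 * s₄ := by
  intro hd
  have hs : s₄ = (s₂ / 2) * (s₂ / 2) := by linarith
  have hu := h (Polynomial.X ^ 2 + Polynomial.C ((s₂ / 2 : ℝ) : ℂ)) ⟨1, by
    have h2 : Polynomial.C (s₂ : ℂ) = 2 * Polynomial.C ((s₂ / 2 : ℝ) : ℂ) := by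
      rw [← Polynomial.C_ofNat, ← Polynomial.C_mul]
      push_cast
      congr 1
      ring
    rw [spectralPoly, h2, hs, Complex.ofReal_mul, Polynomial.C_mul]
    ring⟩
  have := Polynomial.natDegree_eq_zero_of_isUnit hu
  rw [Polynomial.natDegree_X_pow_add_C] at this
  exact two_ne_zero this

end SpectralCurve

/-! ### Equivalence with the Duffing equation, and uniqueness. -/

section ODE

variable {s₂ s₄ : ℝ} {u v p q : ℝ → ℝ}

/-- Solutions of the Duffing equation `u'' = 2 s₂ u - 2 u³` are stationary mKdV solutions. -/
theorem isMovingMKdVSolution_of_duffing (hu : ∀ x, HasDerivAt u (p x) x)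
    (hp : ∀ x, HasDerivAt p (2 * s₂ * u x - 2 * u x ^ 3) x) :
    IsMovingMKdVSolution s₂ (fun ξ _ => u ξ) := by
  have du : deriv u = p := funext fun x => (hu x).deriv
  have dp : deriv p = fun x => 2 * s₂ * u x - 2 * u x ^ 3 := funext fun x => (hp x).deriv
  -- Regularity is bootstrapped from the equation: `u` is C¹, hence `p' = 2 s₂ u - 2 u³` is C¹, `p`
  -- is C² and `u` is C³.
  have c1 : ContDiff ℝ 1 u :=
    contDiff_one_iff_deriv.2 ⟨fun x => (hu x).differentiableAt, by
      rw [du]; exact continuous_iff_continuousAt.2 fun x => (hp x).continuousAt⟩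
  have c2 : ContDiff ℝ 2 p := by
    rw [show (2 : WithTop ℕ∞) = 1 + 1 by norm_num, contDiff_succ_iff_deriv]
    refine ⟨fun x => (hp x).differentiableAt, by simp, ?_⟩
    rw [dp]
    fun_prop
  have c3 : ContDiff ℝ 3 u := by
    rw [show (3 : WithTop ℕ∞) = 2 + 1 by norm_num, contDiff_succ_iff_deriv]
    refine ⟨fun x => (hu x).differentiableAt, by simp, ?_⟩
    rwa [du]
  refine ⟨c3.comp contDiff_fst, fun ξ t => ?_⟩
  have d3 : iteratedDeriv 3 u ξ = 2 * s₂ * p ξ - 6 * u ξ ^ 2 * p ξ := by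
    rw [iteratedDeriv_succ', iteratedDeriv_succ', iteratedDeriv_one, du, dp]
    have h := ((hu ξ).const_mul (2 * s₂)).sub (((hu ξ).pow 3).const_mul 2)
    refine (HasDerivAt.deriv h).trans ?_
    push_cast
    ring
  change deriv (fun _ => u ξ) t - 2 * s₂ * deriv u ξ + iteratedDeriv 3 u ξ
    + 6 * u ξ ^ 2 * deriv u ξ = 0
  rw [deriv_const, d3, du]
  ring

theorem IsEllipticSolution.contDiff (h : IsEllipticSolution s₂ s₄ u) : ContDiff ℝ 3 u :=
  h.solution.1.comp (contDiff_id.prodMk (contDiff_const (c := (0 : ℝ))))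

theorem IsEllipticSolution.hasDerivAt (h : IsEllipticSolution s₂ s₄ u) (x : ℝ) :
    HasDerivAt u (deriv u x) x :=
  (h.contDiff.differentiable (by norm_num) x).hasDerivAt

theorem IsEllipticSolution.exists_deriv_ne_zero (h : IsEllipticSolution s₂ s₄ u) :
    ∃ x, deriv u x ≠ 0 := by
  by_contra! h0
  obtain ⟨ξ, η, hne⟩ := h.nonconstant
  exact hne (is_const_of_deriv_eq_zero (fun x => (h.hasDerivAt x).differentiableAt) h0 ξ η)

theorem IsEllipticSolution.hasDerivAt_deriv (h : IsEllipticSolution s₂ s₄ u) (x : ℝ) :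
    HasDerivAt (deriv u) (2 * s₂ * u x - 2 * u x ^ 3) x := by
  have c2 : ContDiff ℝ 2 (deriv u) := by
    have := h.contDiff
    rw [show (3 : WithTop ℕ∞) = 2 + 1 by norm_num, contDiff_succ_iff_deriv] at this
    exact this.2.2
  have c1 : ContDiff ℝ 1 (deriv (deriv u)) := by
    rw [show (2 : WithTop ℕ∞) = 1 + 1 by norm_num, contDiff_succ_iff_deriv] at c2
    exact c2.2.2
  have h2 : ∀ x, HasDerivAt (deriv u) (deriv (deriv u) x) x := fun x =>
    (c2.differentiable (by norm_num) x).hasDerivAt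
  have h3 : ∀ x, HasDerivAt (deriv (deriv u)) (deriv (deriv (deriv u)) x) x := fun x =>
    (c1.differentiable (by norm_num) x).hasDerivAt
  -- This function is the first integral; the mKdV equation says its derivative vanishes.
  have hG : ∀ x, HasDerivAt (fun x => deriv (deriv u) x - 2 * s₂ * u x + 2 * u x ^ 3) 0 x := by
    intro x
    have hd := ((h3 x).sub ((h.hasDerivAt x).const_mul (2 * s₂))).add
      (((h.hasDerivAt x).pow 3).const_mul 2)
    refine hd.congr_deriv ?_
    have he := h.solution.2 x 0
    change deriv (fun _ => u x) (0 : ℝ) - 2 * s₂ * deriv u x + iteratedDeriv 3 u x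
      + 6 * u x ^ 2 * deriv u x = 0 at he
    rw [deriv_const, iteratedDeriv_succ', iteratedDeriv_succ', iteratedDeriv_one] at he
    push_cast
    linear_combination he
  obtain ⟨x₁, hx₁⟩ := h.exists_deriv_ne_zero
  have hc := is_const_of_deriv_eq_zero (fun x => (hG x).differentiableAt)
    (fun x => (hG x).deriv) x x₁
  -- Both sides of `u'² = -R(u)` are differentiated at `x₁` and the factor `2u'(x₁) ≠ 0` is
  -- cancelled; this fixes the integration constant at zero.
  have hprof : deriv (deriv u) x₁ = 2 * s₂ * u x₁ - 2 * u x₁ ^ 3 := by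
    have hl := (h2 x₁).pow 2
    have hr := (((((h.hasDerivAt x₁).pow 2).sub_const s₂).pow 2).sub_const (4 * s₄)).neg
    have heq := hl.unique (hr.congr_of_eventuallyEq (Filter.Eventually.of_forall fun x => by
      simpa [R] using h.profile x))
    refine mul_left_cancel₀ (mul_ne_zero two_ne_zero hx₁) ?_
    simp only [Pi.pow_apply, Nat.cast_ofNat] at heq
    norm_num at heq
    linear_combination heq
  have : deriv (deriv u) x = 2 * s₂ * u x - 2 * u x ^ 3 := by
    linear_combination hc + hprof
  exact this ▸ h2 x

/-- Uniqueness for the Duffing equation `u'' = 2 s₂ u - 2 u³` among bounded solutions. -/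
theorem duffing_unique {M : ℝ} (hu : ∀ x, HasDerivAt u (p x) x)
    (hp : ∀ x, HasDerivAt p (2 * s₂ * u x - 2 * u x ^ 3) x)
    (hv : ∀ x, HasDerivAt v (q x) x)
    (hq : ∀ x, HasDerivAt q (2 * s₂ * v x - 2 * v x ^ 3) x)
    (hub : ∀ x, |u x| ≤ M) (hvb : ∀ x, |v x| ≤ M) (h0 : u 0 = v 0) (h0' : p 0 = q 0) :
    u = v := by
  have hM : 0 ≤ M := (abs_nonneg _).trans (hub 0)
  let f : ℝ → ℝ × ℝ → ℝ × ℝ := fun _ z => (z.2, 2 * s₂ * z.1 - 2 * z.1 ^ 3)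
  -- The cubic field is only locally Lipschitz, so it is restricted to the strip `|z.1| ≤ M`. There
  -- the difference quotient of the second component is at most `2|s₂| + 6M²`; the summand `1`
  -- covers the first.
  let L : NNReal := Real.toNNReal (1 + (2 * |s₂| + 6 * M ^ 2))
  have hL : (L : ℝ) = 1 + (2 * |s₂| + 6 * M ^ 2) := Real.coe_toNNReal _ (by positivity)
  have hf : ∀ t, LipschitzOnWith L (f t) {z : ℝ × ℝ | |z.1| ≤ M} := by
    intro t
    refine LipschitzOnWith.of_dist_le_mul fun z hz w hw => ?_
    rw [hL]
    have h1 : |z.1 - w.1| ≤ dist z w := (Real.dist_eq _ _).symm.le.trans (le_max_left _ _)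
    have h2 : |z.2 - w.2| ≤ dist z w := (Real.dist_eq _ _).symm.le.trans (le_max_right _ _)
    have hD : 0 ≤ dist z w := dist_nonneg
    have hcub : |2 * s₂ - 2 * (z.1 ^ 2 + z.1 * w.1 + w.1 ^ 2)| ≤ 2 * |s₂| + 6 * M ^ 2 := by
      have ha := abs_le.1 (show |z.1| ≤ M from hz)
      have hb := abs_le.1 (show |w.1| ≤ M from hw)
      have hs := abs_le.1 (le_refl |s₂|)
      rw [abs_le]
      constructor <;> nlinarith
    refine max_le ?_ ?_
    · change dist z.2 w.2 ≤ _
      rw [Real.dist_eq]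
      have : 0 ≤ (2 * |s₂| + 6 * M ^ 2) * dist z w := by positivity
      linarith
    · change dist (2 * s₂ * z.1 - 2 * z.1 ^ 3) (2 * s₂ * w.1 - 2 * w.1 ^ 3) ≤ _
      rw [Real.dist_eq, show 2 * s₂ * z.1 - 2 * z.1 ^ 3 - (2 * s₂ * w.1 - 2 * w.1 ^ 3) =
        (2 * s₂ - 2 * (z.1 ^ 2 + z.1 * w.1 + w.1 ^ 2)) * (z.1 - w.1) by ring, abs_mul]
      have := mul_le_mul hcub h1 (abs_nonneg _) (by positivity)
      linarith
  have := ODE_solution_unique_univ (t₀ := 0) (f := fun x => (u x, p x)) (g := fun x => (v x, q x))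
    (s := fun _ => {z : ℝ × ℝ | |z.1| ≤ M}) hf
    (fun t => ⟨(hu t).prodMk (hp t), hub t⟩) (fun t => ⟨(hv t).prodMk (hq t), hvb t⟩)
    (by simp [h0, h0'])
  exact funext fun x => congrArg Prod.fst (congrFun this x)

end ODE

/-! ### The `cn` and `dn` profiles and their characterization. -/

section Profiles

variable {α k : ℝ}

theorem hasDerivAt_cn_profile (h0 : 0 ≤ k) (h1 : k < 1) (α σ ξ₀ x : ℝ) :
    HasDerivAt (fun ξ => σ * (k * α * cnR k (α * (ξ - ξ₀))))
      (-(σ * (k * α ^ 2 * (snR k (α * (x - ξ₀)) * dnR k (α * (x - ξ₀)))))) x := by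
  have hl : HasDerivAt (fun ξ => α * (ξ - ξ₀)) α x := by
    simpa using ((hasDerivAt_id x).sub_const ξ₀).const_mul α
  refine ((((hasDerivAt_cnR h0 h1 _).comp x hl).const_mul (k * α)).const_mul σ).congr_deriv ?_
  ring

theorem hasDerivAt_cn_profile_deriv (h0 : 0 ≤ k) (h1 : k < 1) (α ξ₀ x : ℝ) {σ : ℝ}
    (hσ : σ = 1 ∨ σ = -1) :
    HasDerivAt (fun x => -(σ * (k * α ^ 2 * (snR k (α * (x - ξ₀)) * dnR k (α * (x - ξ₀))))))
      (2 * ((2 * k ^ 2 - 1) * α ^ 2 / 2) * (σ * (k * α * cnR k (α * (x - ξ₀))))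
        - 2 * (σ * (k * α * cnR k (α * (x - ξ₀)))) ^ 3) x := by
  have hl : HasDerivAt (fun ξ => α * (ξ - ξ₀)) α x := by
    simpa using ((hasDerivAt_id x).sub_const ξ₀).const_mul α
  refine (((((hasDerivAt_snR h0 h1 _).comp x hl).mul
    ((hasDerivAt_dnR h0 h1 _).comp x hl)).const_mul (k * α ^ 2)).const_mul σ).neg.congr_deriv ?_
  -- The Duffing field is odd, so the sign passes through the cubic term.
  have hs : σ ^ 3 = σ := by rcases hσ with rfl | rfl <;> norm_num
  simp only [Function.comp]
  rw [mul_pow σ, hs]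
  have hsc := snR_sq_add_cnR_sq k (α * (x - ξ₀))
  have hd := dnR_sq h0 h1 (α * (x - ξ₀))
  generalize snR k (α * (x - ξ₀)) = s at *
  generalize cnR k (α * (x - ξ₀)) = c at *
  generalize dnR k (α * (x - ξ₀)) = d at *
  linear_combination -σ * k * α ^ 3 * c * hd + 2 * σ * k ^ 3 * α ^ 3 * c * hsc

theorem hasDerivAt_dn_profile (h0 : 0 ≤ k) (h1 : k < 1) (α σ ξ₀ x : ℝ) :
    HasDerivAt (fun ξ => σ * (α * dnR k (α * (ξ - ξ₀))))
      (-(σ * (k ^ 2 * α ^ 2 * (snR k (α * (x - ξ₀)) * cnR k (α * (x - ξ₀)))))) x := by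
  have hl : HasDerivAt (fun ξ => α * (ξ - ξ₀)) α x := by
    simpa using ((hasDerivAt_id x).sub_const ξ₀).const_mul α
  refine ((((hasDerivAt_dnR h0 h1 _).comp x hl).const_mul α).const_mul σ).congr_deriv ?_
  ring

theorem hasDerivAt_dn_profile_deriv (h0 : 0 ≤ k) (h1 : k < 1) (α ξ₀ x : ℝ) {σ : ℝ}
    (hσ : σ = 1 ∨ σ = -1) :
    HasDerivAt (fun x => -(σ * (k ^ 2 * α ^ 2 * (snR k (α * (x - ξ₀)) * cnR k (α * (x - ξ₀))))))
      (2 * ((2 - k ^ 2) * α ^ 2 / 2) * (σ * (α * dnR k (α * (x - ξ₀))))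
        - 2 * (σ * (α * dnR k (α * (x - ξ₀)))) ^ 3) x := by
  have hl : HasDerivAt (fun ξ => α * (ξ - ξ₀)) α x := by
    simpa using ((hasDerivAt_id x).sub_const ξ₀).const_mul α
  refine (((((hasDerivAt_snR h0 h1 _).comp x hl).mul
    ((hasDerivAt_cnR h0 h1 _).comp x hl)).const_mul (k ^ 2 * α ^ 2)).const_mul σ).neg.congr_deriv ?_
  have hs : σ ^ 3 = σ := by rcases hσ with rfl | rfl <;> norm_num
  simp only [Function.comp]
  rw [mul_pow σ, hs]
  have hsc := snR_sq_add_cnR_sq k (α * (x - ξ₀))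
  have hd := dnR_sq h0 h1 (α * (x - ξ₀))
  generalize snR k (α * (x - ξ₀)) = s at *
  generalize cnR k (α * (x - ξ₀)) = c at *
  generalize dnR k (α * (x - ξ₀)) = d at *
  linear_combination -σ * k ^ 2 * α ^ 3 * d * hsc + 2 * σ * α ^ 3 * d * hd

theorem cn_profile_sq (h0 : 0 ≤ k) (h1 : k < 1) (α x : ℝ) :
    (k * α ^ 2 * (snR k x * dnR k x)) ^ 2 =
      -R ((2 * k ^ 2 - 1) * α ^ 2 / 2) (α ^ 4 / 16) (k * α * cnR k x) := by
  have hs : snR k x ^ 2 = 1 - cnR k x ^ 2 := by linarith [snR_sq_add_cnR_sq k x]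
  rw [mul_pow, mul_pow (snR k x), dnR_sq h0 h1, hs, R]
  ring

theorem dn_profile_sq (h0 : 0 ≤ k) (h1 : k < 1) (α x : ℝ) :
    (k ^ 2 * α ^ 2 * (snR k x * cnR k x)) ^ 2 =
      -R ((2 - k ^ 2) * α ^ 2 / 2) (k ^ 4 * α ^ 4 / 16) (α * dnR k x) := by
  have hs : cnR k x ^ 2 = 1 - snR k x ^ 2 := by linarith [snR_sq_add_cnR_sq k x]
  rw [mul_pow, mul_pow (snR k x), hs, R, mul_pow α, dnR_sq h0 h1]
  ring

theorem isEllipticSolution_cn (hα : 0 < α) (h0 : 0 < k) (h1 : k < 1) :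
    IsEllipticSolution ((2 * k ^ 2 - 1) * α ^ 2 / 2) (α ^ 4 / 16)
      (fun ξ => k * α * cnR k (α * ξ)) := by
  have hd := fun x => hasDerivAt_cn_profile h0.le h1 α 1 0 x
  have hdd := fun x => hasDerivAt_cn_profile_deriv h0.le h1 α 0 x (Or.inl rfl : (1 : ℝ) = 1 ∨ _)
  simp only [one_mul, sub_zero] at hd hdd
  refine ⟨isMovingMKdVSolution_of_duffing hd hdd, fun ξ => ?_, squarefree_spectralPoly ?_ ?_, ?_⟩
  · rw [(hd ξ).deriv, neg_sq, cn_profile_sq h0.le h1]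
  · positivity
  -- Here `s₂² - 4s₄ = -k²(1 - k²)α⁴`.
  · have h : 0 < k ^ 2 * (1 - k ^ 2) * α ^ 4 := by
      have : 0 < 1 - k ^ 2 := by nlinarith
      positivity
    intro he
    nlinarith
  · refine ⟨0, ellipticK k / α, ?_⟩
    rw [mul_zero, mul_div_cancel₀ _ hα.ne', cnR_zero h0.le h1, cnR_ellipticK h0.le h1]
    simp [h0.ne', hα.ne']

theorem isEllipticSolution_dn (hα : 0 < α) (h0 : 0 < k) (h1 : k < 1) :
    IsEllipticSolution ((2 - k ^ 2) * α ^ 2 / 2) (k ^ 4 * α ^ 4 / 16)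
      (fun ξ => α * dnR k (α * ξ)) := by
  have hd := fun x => hasDerivAt_dn_profile h0.le h1 α 1 0 x
  have hdd := fun x => hasDerivAt_dn_profile_deriv h0.le h1 α 0 x (Or.inl rfl : (1 : ℝ) = 1 ∨ _)
  simp only [one_mul, sub_zero] at hd hdd
  refine ⟨isMovingMKdVSolution_of_duffing hd hdd, fun ξ => ?_, squarefree_spectralPoly ?_ ?_, ?_⟩
  · rw [(hd ξ).deriv, neg_sq, dn_profile_sq h0.le h1]
  · positivity
  -- Here `s₂² - 4s₄ = (1 - k²)α⁴`.
  · have h : 0 < (1 - k ^ 2) * α ^ 4 := by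
      have : 0 < 1 - k ^ 2 := by nlinarith
      positivity
    intro he
    nlinarith
  · refine ⟨0, ellipticK k / α, ?_⟩
    rw [mul_zero, mul_div_cancel₀ _ hα.ne', dnR_zero h0.le h1, dnR_ellipticK h0.le h1]
    intro he
    have := mul_left_cancel₀ hα.ne' he
    exact (compl_lt_one h0).ne' this

/-- No sign is needed: `cn` takes every value in `[-1, 1]`, so a translation already reaches all
initial data. -/
theorem IsEllipticSolution.eq_cn {u : ℝ → ℝ} (hα : 0 < α) (h0 : 0 < k) (h1 : k < 1)
    (h : IsEllipticSolution ((2 * k ^ 2 - 1) * α ^ 2 / 2) (α ^ 4 / 16) u) :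
    ∃ ξ₀, ∀ ξ, u ξ = 1 * (k * α * cnR k (α * (ξ - ξ₀))) := by
  have hkα : 0 < k * α := mul_pos h0 hα
  have hub : ∀ x, |u x| ≤ k * α := by
    intro x
    have hp := h.profile x
    rw [R] at hp
    refine abs_le_of_sq_le_sq ?_ hkα.le
    -- `-R(u) = u'² ≥ 0` means `|u² - s₂| ≤ 2√s₄`, and here `2√s₄ = α²/2`.
    have : |u x ^ 2 - (2 * k ^ 2 - 1) * α ^ 2 / 2| ≤ α ^ 2 / 2 :=
      abs_le_of_sq_le_sq (by nlinarith [sq_nonneg (deriv u x)]) (by positivity)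
    nlinarith [(abs_le.1 this).2]
  have hvb : ∀ ξ₀ x, |1 * (k * α * cnR k (α * (x - ξ₀)))| ≤ k * α := by
    intro ξ₀ x
    rw [one_mul, abs_mul, abs_of_pos hkα]
    exact mul_le_of_le_one_right hkα.le (Real.abs_cos_le_one _)
  have hc := abs_le.1 (hub 0)
  obtain ⟨x, hx⟩ := exists_cnR_eq (k := k) h0.le h1 (c := u 0 / (k * α))
    (by rw [le_div_iff₀ hkα]; linarith [hc.1]) (by rw [div_le_one hkα]; exact hc.2)
  have hx' : u 0 = k * α * cnR k x := by rw [hx, mul_div_cancel₀ _ hkα.ne']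
  have hsq := h.profile 0
  rw [hx', ← cn_profile_sq h0.le h1] at hsq
  obtain ⟨y, hy, hy'⟩ : ∃ y, u 0 = k * α * cnR k y ∧
      deriv u 0 = -(k * α ^ 2 * (snR k y * dnR k y)) := by
    -- The slope is known up to sign; since `cn`, `dn` are even and `sn` is odd, replacing `x` by
    -- `-x` flips the slope and keeps the value.
    rcases sq_eq_sq_iff_eq_or_eq_neg.1 hsq with he | he
    · refine ⟨-x, by rw [cnR_neg h0.le h1, hx'], ?_⟩
      rw [he, snR_neg h0.le h1, dnR_neg h0.le h1]
      ring
    · exact ⟨x, hx', he⟩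
  have hα0 : α * (0 - -y / α) = y := by field_simp; ring
  refine ⟨-y / α, congrFun (duffing_unique h.hasDerivAt h.hasDerivAt_deriv
    (hasDerivAt_cn_profile h0.le h1 α 1 (-y / α))
    (fun x => hasDerivAt_cn_profile_deriv h0.le h1 α (-y / α) x (Or.inl rfl)) hub (hvb _) ?_ ?_)⟩
  · rw [hα0, hy, one_mul]
  · rw [hα0, hy', one_mul]

/-- Since `dn > 0`, the sign of `u 0` must be carried by `σ`; the bounds on `u²` put `|u 0| / α` in
the range `[k', 1]` of `dn`. -/
theorem IsEllipticSolution.eq_dn {u : ℝ → ℝ} (hα : 0 < α) (h0 : 0 < k) (h1 : k < 1)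
    (h : IsEllipticSolution ((2 - k ^ 2) * α ^ 2 / 2) (k ^ 4 * α ^ 4 / 16) u) :
    ∃ ξ₀ σ, (σ = 1 ∨ σ = -1) ∧ ∀ ξ, u ξ = σ * (α * dnR k (α * (ξ - ξ₀))) := by
  have hb : ∀ x, α ^ 2 * (1 - k ^ 2) ≤ u x ^ 2 ∧ u x ^ 2 ≤ α ^ 2 := by
    intro x
    have hp := h.profile x
    rw [R] at hp
    have : |u x ^ 2 - (2 - k ^ 2) * α ^ 2 / 2| ≤ k ^ 2 * α ^ 2 / 2 :=
      abs_le_of_sq_le_sq (by nlinarith [sq_nonneg (deriv u x)]) (by positivity)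
    constructor <;> nlinarith [(abs_le.1 this).1, (abs_le.1 this).2]
  have hub : ∀ x, |u x| ≤ α := fun x => abs_le_of_sq_le_sq (hb x).2 hα.le
  obtain ⟨σ, hσ, hσu⟩ : ∃ σ : ℝ, (σ = 1 ∨ σ = -1) ∧ u 0 = σ * |u 0| := by
    rcases abs_cases (u 0) with ⟨he, _⟩ | ⟨he, _⟩
    · exact ⟨1, Or.inl rfl, by rw [he, one_mul]⟩
    · exact ⟨-1, Or.inr rfl, by rw [he]; ring⟩
  have hσ2 : σ ^ 2 = 1 := by rcases hσ with rfl | rfl <;> norm_num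
  have hσabs : |σ| = 1 := by rcases hσ with rfl | rfl <;> norm_num
  have hvb : ∀ ξ₀ x, |σ * (α * dnR k (α * (x - ξ₀)))| ≤ α := by
    intro ξ₀ x
    rw [abs_mul, hσabs, one_mul, abs_mul, abs_of_pos hα]
    refine mul_le_of_le_one_right hα.le (abs_le_of_sq_le_sq ?_ zero_le_one)
    rw [dnR_sq h0.le h1]
    nlinarith [sq_nonneg (k * snR k (α * (x - ξ₀)))]
  have hα2 : 0 < α ^ 2 := by positivity
  obtain ⟨x, hx⟩ := exists_dnR_eq h0 h1 (d := |u 0| / α) (by positivity)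
    (by rw [div_pow, sq_abs, le_div_iff₀ hα2]; linarith [(hb 0).1])
    (by rw [div_pow, sq_abs, div_le_one hα2]; exact (hb 0).2)
  have hx' : u 0 = σ * (α * dnR k x) := by rw [hx, mul_div_cancel₀ _ hα.ne', ← hσu]
  have hsq := h.profile 0
  rw [show R ((2 - k ^ 2) * α ^ 2 / 2) (k ^ 4 * α ^ 4 / 16) (u 0) =
    R ((2 - k ^ 2) * α ^ 2 / 2) (k ^ 4 * α ^ 4 / 16) (α * dnR k x) by
      rw [R, R, hx', mul_pow σ, hσ2, one_mul], ← dn_profile_sq h0.le h1] at hsq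
  obtain ⟨y, hy, hy'⟩ : ∃ y, u 0 = σ * (α * dnR k y) ∧
      deriv u 0 = -(σ * (k ^ 2 * α ^ 2 * (snR k y * cnR k y))) := by
    have hsq' : deriv u 0 ^ 2 = (σ * (k ^ 2 * α ^ 2 * (snR k x * cnR k x))) ^ 2 := by
      rw [hsq, mul_pow σ, hσ2, one_mul]
    rcases sq_eq_sq_iff_eq_or_eq_neg.1 hsq' with he | he
    · refine ⟨-x, by rw [dnR_neg h0.le h1, hx'], ?_⟩
      rw [he, snR_neg h0.le h1, cnR_neg h0.le h1]
      ring
    · exact ⟨x, hx', he⟩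
  have hα0 : α * (0 - -y / α) = y := by field_simp; ring
  refine ⟨-y / α, σ, hσ, congrFun (duffing_unique h.hasDerivAt h.hasDerivAt_deriv
    (hasDerivAt_dn_profile h0.le h1 α σ (-y / α))
    (fun x => hasDerivAt_dn_profile_deriv h0.le h1 α (-y / α) x hσ) hub (hvb _) ?_ ?_)⟩
  · rw [hα0, hy]
  · rw [hα0, hy']

/-- The parameters of an elliptic function solution are those of a `cn` or a `dn` profile. -/
theorem IsEllipticSolution.exists_scale_modulus {s₂ s₄ : ℝ} {u : ℝ → ℝ}
    (h : IsEllipticSolution s₂ s₄ u) :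
    ∃ α k : ℝ, 0 < α ∧ 0 < k ∧ k < 1 ∧
      ((s₂ = (2 * k ^ 2 - 1) * α ^ 2 / 2 ∧ s₄ = α ^ 4 / 16) ∨
        (s₂ = (2 - k ^ 2) * α ^ 2 / 2 ∧ s₄ = k ^ 4 * α ^ 4 / 16)) := by
  obtain ⟨x, hx⟩ := h.exists_deriv_ne_zero
  have hp := h.profile x
  have hpos : 0 < deriv u x ^ 2 := by positivity
  rw [R] at hp
  have h4 : 0 < s₄ := by nlinarith [sq_nonneg (u x ^ 2 - s₂)]
  obtain ⟨r, hr, rfl⟩ : ∃ r, 0 < r ∧ s₄ = r ^ 2 :=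
    ⟨Real.sqrt s₄, Real.sqrt_pos.2 h4, (Real.sq_sqrt h4.le).symm⟩
  -- At the chosen point `u' ≠ 0`, so `|u² - s₂| < 2r` strictly and `0 ≤ u² < s₂ + 2r`.
  have h3 : 0 < s₂ + 2 * r := by
    have := abs_lt_of_sq_lt_sq (show (u x ^ 2 - s₂) ^ 2 < (2 * r) ^ 2 by linarith) (by linarith)
    nlinarith [(abs_lt.1 this).2, sq_nonneg (u x)]
  have hne : s₂ ≠ 2 * r := by
    rintro rfl
    exact discrim_ne_of_squarefree h.genus_one (by ring)
  -- The witnesses are `α² = u₃ - u₁` and `k² = (u₃ - u₂)/(u₃ - u₁)`, with ordered roots `s₂ - 2r,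
  -- 0, s₂ + 2r` in the first case and `0, s₂ - 2r, s₂ + 2r` in the second.
  rcases hne.lt_or_gt with hlt | hgt
  · have hq : 0 < (s₂ + 2 * r) / (4 * r) := by positivity
    have hα : Real.sqrt (4 * r) ^ 2 = 4 * r := Real.sq_sqrt (by linarith)
    refine ⟨Real.sqrt (4 * r), Real.sqrt ((s₂ + 2 * r) / (4 * r)), Real.sqrt_pos.2 (by linarith),
      Real.sqrt_pos.2 hq, (Real.sqrt_lt' one_pos).2 ?_, Or.inl ⟨?_, ?_⟩⟩
    · rw [one_pow, div_lt_one (by linarith)]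
      linarith
    · rw [Real.sq_sqrt hq.le, hα]
      field_simp
      ring
    · rw [show (4 : ℕ) = 2 * 2 from rfl, pow_mul, hα]
      ring
  · have hq : 0 < 4 * r / (s₂ + 2 * r) := by positivity
    have hα : Real.sqrt (s₂ + 2 * r) ^ 2 = s₂ + 2 * r := Real.sq_sqrt h3.le
    refine ⟨Real.sqrt (s₂ + 2 * r), Real.sqrt (4 * r / (s₂ + 2 * r)), Real.sqrt_pos.2 h3,
      Real.sqrt_pos.2 hq, (Real.sqrt_lt' one_pos).2 ?_, Or.inr ⟨?_, ?_⟩⟩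
    · rw [one_pow, div_lt_one h3]
      linarith
    · rw [Real.sq_sqrt hq.le, hα]
      field_simp
      ring
    · rw [show (4 : ℕ) = 2 * 2 from rfl, pow_mul, pow_mul, hα, Real.sq_sqrt hq.le]
      rw [div_pow, div_mul_cancel₀ _ (pow_ne_zero 2 h3.ne')]
      ring

end Profiles

end MKdV

theorem mainTheorem8 :
    -- every elliptic function solution has the stated form
    (∀ (s₂ s₄ : ℝ) (u : ℝ → ℝ), MKdV.IsEllipticSolution s₂ s₄ u →
      ∃ u₁ u₂ u₃ α k l ξ₀ σ : ℝ,
        (u₁ ≤ 0 ∧ 0 ≤ u₂ ∧ u₂ < u₃) ∧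
        (∀ X : ℝ, X * ((X - s₂) ^ 2 - 4 * s₄) = (X - u₁) * (X - u₂) * (X - u₃)) ∧
        s₂ = (u₁ + u₂ + u₃) / 2 ∧
        0 < α ∧ 0 < k ∧ k < 1 ∧ (l = 0 ∨ l = MKdV.ellipticK' k / 2) ∧
        MKdV.Parametrized u₁ u₂ u₃ α k l ∧
        MKdV.SquareFormula α k l ξ₀ u ∧
        (σ = 1 ∨ σ = -1) ∧ MKdV.CnOrDnType α k l ξ₀ σ u) ∧
    -- and every admissible triple of parameters occurs
    (∀ α k l : ℝ, 0 < α → 0 < k → k < 1 → (l = 0 ∨ l = MKdV.ellipticK' k / 2) →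
      ∃ (u₁ u₂ u₃ s₄ : ℝ) (u : ℝ → ℝ),
        (u₁ ≤ 0 ∧ 0 ≤ u₂ ∧ u₂ < u₃) ∧
        (∀ X : ℝ, X * ((X - (u₁ + u₂ + u₃) / 2) ^ 2 - 4 * s₄)
          = (X - u₁) * (X - u₂) * (X - u₃)) ∧
        MKdV.Parametrized u₁ u₂ u₃ α k l ∧
        MKdV.IsEllipticSolution ((u₁ + u₂ + u₃) / 2) s₄ u ∧
        MKdV.SquareFormula α k l 0 u ∧
        MKdV.CnOrDnType α k l 0 1 u) := by
  constructor
  · intro s₂ s₄ u h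
    obtain ⟨α, k, hα, h0, h1, ⟨rfl, rfl⟩ | ⟨rfl, rfl⟩⟩ := h.exists_scale_modulus
    · obtain ⟨ξ₀, hu⟩ := h.eq_cn hα h0 h1
      -- The three roots left open are determined by unification with `MKdV.parametrized_cn`.
      refine ⟨_, _, _, α, k, 0, ξ₀, 1, ⟨?_, le_rfl, by positivity⟩, fun X => by ring, by ring, hα,
        h0, h1, Or.inl rfl, MKdV.parametrized_cn hα h0 h1,
        MKdV.squareFormula_cn h0 h1 (Or.inl rfl) hu, Or.inl rfl, MKdV.cnOrDnType_cn h0 hu⟩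
      nlinarith [mul_nonneg (sq_nonneg α) (show 0 ≤ 1 - k ^ 2 by nlinarith)]
    · obtain ⟨ξ₀, σ, hσ, hu⟩ := h.eq_dn hα h0 h1
      refine ⟨_, _, _, α, k, _, ξ₀, σ, ⟨le_rfl, ?_, ?_⟩, fun X => by ring, by ring, hα,
        h0, h1, Or.inr rfl, MKdV.parametrized_dn hα h0 h1,
        MKdV.squareFormula_dn h0 h1 hσ hu, hσ, MKdV.cnOrDnType_dn h0 hu⟩
      · exact mul_nonneg (sq_nonneg α) (by nlinarith)
      · nlinarith [mul_pos (pow_pos hα 2) (pow_pos h0 2)]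
  · rintro α k l hα h0 h1 (rfl | rfl)
    · have hu : ∀ ξ, k * α * MKdV.cnR k (α * ξ) = 1 * (k * α * MKdV.cnR k (α * (ξ - 0))) := by
        simp
      refine ⟨_, _, _, α ^ 4 / 16, fun ξ => k * α * MKdV.cnR k (α * ξ), ⟨?_, le_rfl, by positivity⟩,
        fun X => by ring, MKdV.parametrized_cn hα h0 h1, ?_,
        MKdV.squareFormula_cn h0 h1 (Or.inl rfl) hu, MKdV.cnOrDnType_cn h0 hu⟩
      · nlinarith [mul_nonneg (sq_nonneg α) (show 0 ≤ 1 - k ^ 2 by nlinarith)]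
      · convert MKdV.isEllipticSolution_cn hα h0 h1 using 1
        ring
    · have hu : ∀ ξ, α * MKdV.dnR k (α * ξ) = 1 * (α * MKdV.dnR k (α * (ξ - 0))) := by simp
      refine ⟨_, _, _, k ^ 4 * α ^ 4 / 16, fun ξ => α * MKdV.dnR k (α * ξ), ⟨le_rfl, ?_, ?_⟩,
        fun X => by ring, MKdV.parametrized_dn hα h0 h1, ?_,
        MKdV.squareFormula_dn h0 h1 (Or.inl rfl) hu, MKdV.cnOrDnType_dn h0 hu⟩
      · exact mul_nonneg (sq_nonneg α) (by nlinarith)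
      · nlinarith [mul_pos (pow_pos hα 2) (pow_pos h0 2)]
      · convert MKdV.isEllipticSolution_dn hα h0 h1 using 1
        ring
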